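/- Let $N\ge 1$ and let $B=[b_{ij}]\in\mathbb{R}^{N\times N}$ be the adjacency matrix ($b_{ii}=0$; $b_{ij}>0$ friendly, $b_{ij}<0$ antagonistic) of a strongly connected signed graph that is undirected, i.e. $B=B^{\mathrm T}$. Let $\sigma_1,\dots,\sigma_N>0$, $\Sigma=\mathrm{diag}(\sigma_1,\dots,\sigma_N)$, $E=B-\Sigma$, and consider the stubborn positives opinion dynamics $$\dot x=A(x)Ex,\qquad A(x)=\tfrac12\,(I-\mathrm{diag}(x)),\qquad t\ge 0,$$ with $x(0)\in[-1,1]^N$. Write $\rho(\cdot)$ for the spectral radius, and call a real square matrix $M$ eventually positive if there is an integer $k_0\ge1$ such that all entries of $M^k$ are positive for every $k\ge k_0$. Suppose that one of the following holds: (Assumption 1) $B$ is eventually positive and $\sigma_1=\dots=\sigma_N=:d\ge\rho(B)$; in this case put $C:=B$; (Assumption 2) $B$ is not eventually positive, and $d\in\mathbb{R}$ is such that $C:=B+(dI-\Sigma)$ is eventually positive and $d\ge\rho(C)$. (In both cases $E=C-dI$.) Then $C$ has an entrywise positive right eigenvector for the eigenvalue $\rho(C)$. Let $v_r$ be any such eigenvector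 and $\|v_r\|_\infty=\max_i|v_{ri}|$. The following hold. 1) Every solution with $x_i(0)\in[-1,1)$ for all $i$ satisfies $\lim_{t\to\infty}x(t)=\alpha v_r$ for some real $\alpha<\frac1{\|v_r\|_\infty}$. If moreover the states remain opinions in $[-1,1]$, i.e. $x(t)\in[-1,1]^N$ for all $t\ge0$, then $\alpha\in\big[-\frac1{\|v_r\|_\infty},\frac1{\|v_r\|_\infty}\big)$. 2) Let $\mathcal I\subset\{1,\dots,N\}$ be nonempty with nonempty complement, and let $\bar E_{22}=(e_{ij})_{i,j\notin\mathcal I}$ and $\bar E_{21}=(e_{ij})_{i\notin\mathcal I,\,j\in\mathcal I}$. Suppose that $\bar E_{22}$ is nonsingular and that all entries of $y_2^\ast:=-\bar E_{22}^{-1}\bar E_{21}\mathbf 1$ lie in $[-1,1)$. Let $x^\ast\in\mathbb{R}^N$ have the entries $1$ on $\mathcal I$ and the entries of $y_2^\ast$ off $\mathcal I$. Then $x^\ast$ is an equilibrium, and every solution with $x_i(0)=1$ for $i\in\mathcal I$ and $x_i(0)\in[-1,1)$ for $i\notin\mathcal I$ satisfies $\lim_{t\to\infty}x(t)=x^\ast$.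 3) If $d=\rho(C)$, $v_r\ne\mathbf 1$ and $\mathcal J=\{j: v_{rj}=\|v_r\|_\infty\}$, then every solution with $x_i(0)=1$ for $i\in\mathcal J$ and $x_i(0)\in[-1,1)$ for $i\notin\mathcal J$ satisfies $\lim_{t\to\infty}x(t)=\frac{1}{\|v_r\|_\infty}v_r$. -/

import Mathlib

open Filter Topology

namespace OpinionDynamics

noncomputable section

/-- The spectral radius of a real square matrix: the largest modulus of a complex eigenvalue. -/
def specRadius {N : ℕ} (M : Matrix (Fin N) (Fin N) ℝ) : ℝ :=
  (spectralRadius ℂ (M.map (fun r : ℝ => (r : ℂ)))).toReal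

/-- All sufficiently high powers of the matrix are entrywise positive. -/
def EventuallyPositive {N : ℕ} (M : Matrix (Fin N) (Fin N) ℝ) : Prop :=
  ∃ k₀ : ℕ, 0 < k₀ ∧ ∀ k : ℕ, k₀ ≤ k → ∀ i j : Fin N, 0 < (M ^ k) i j

/-- `B` is the adjacency matrix, without self-loops, of a strongly connected signed digraph:
`(i, j)` is an edge when `B i j ≠ 0`, friendly when positive, antagonistic when negative. -/
structure IsSignedAdjacency {N : ℕ} (B : Matrix (Fin N) (Fin N) ℝ) : Prop where
  diag_zero : ∀ i, B i i = 0
  strongly_connected : ∀ i j : Fin N, i ≠ j → Relation.TransGen (fun a b => B a b ≠ 0) i j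

/-- The matrix `E = B - Σ` of the opinion dynamics, with `Σ = diag(σ₁, …, σ_N)`. -/
def systemMatrix {N : ℕ} (B : Matrix (Fin N) (Fin N) ℝ) (σ : Fin N → ℝ) :
    Matrix (Fin N) (Fin N) ℝ :=
  B - Matrix.diagonal σ

/-- The matrix `C = B + D`, `D = d I - Σ`, so that `E = C - d I`. -/
def shiftedMatrix {N : ℕ} (B : Matrix (Fin N) (Fin N) ℝ) (σ : Fin N → ℝ) (d : ℝ) :
    Matrix (Fin N) (Fin N) ℝ :=
  B + (d • (1 : Matrix (Fin N) (Fin N) ℝ) - Matrix.diagonal σ)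

/-- `B` is eventually positive and all forgetting factors have a common value `d ≥ ρ(B)`. -/
def AssumptionOne {N : ℕ} (B : Matrix (Fin N) (Fin N) ℝ) (σ : Fin N → ℝ) (d : ℝ) : Prop :=
  EventuallyPositive B ∧ (∀ i, σ i = d) ∧ specRadius B ≤ d

/-- `B` is not eventually positive, but `C = B + (d I - Σ)` is, and `d ≥ ρ(C)`. -/
def AssumptionTwo {N : ℕ} (B : Matrix (Fin N) (Fin N) ℝ) (σ : Fin N → ℝ) (d : ℝ) : Prop :=
  ¬ EventuallyPositive B ∧ EventuallyPositive (shiftedMatrix B σ d) ∧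
    specRadius (shiftedMatrix B σ d) ≤ d

/-- `v` is an entrywise positive right eigenvector of `M` for the eigenvalue `ρ(M)`. -/
def IsRightPositiveEigenvector {N : ℕ} (M : Matrix (Fin N) (Fin N) ℝ) (v : Fin N → ℝ) : Prop :=
  (∀ i, 0 < v i) ∧ M.mulVec v = specRadius M • v

/-- The susceptibility matrix `A(x) = 0.5 (I - diag(x))` of the stubborn positives scenario. -/
def susceptibility {N : ℕ} (x : Fin N → ℝ) : Matrix (Fin N) (Fin N) ℝ :=
  (1 / 2 : ℝ) • (1 - Matrix.diagonal x)

/-- The vector field `x ↦ A(x) E x`. -/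
def field {N : ℕ} (E : Matrix (Fin N) (Fin N) ℝ) (x : Fin N → ℝ) : Fin N → ℝ :=
  (susceptibility x).mulVec (E.mulVec x)

/-- `x` solves `ẋ = A(x) E x` on `[0, ∞)` (one-sided derivative at `0`). -/
def IsSolution {N : ℕ} (E : Matrix (Fin N) (Fin N) ℝ) (x : ℝ → Fin N → ℝ) : Prop :=
  ∀ t : ℝ, 0 ≤ t → HasDerivWithinAt x (field E (x t)) (Set.Ici 0) t

/-- The point `x` is an equilibrium of `ẋ = A(x) E x`. -/
def IsEquilibrium {N : ℕ} (E : Matrix (Fin N) (Fin N) ℝ) (x : Fin N → ℝ) : Prop :=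
  field E x = 0

/-- The block `Ē₂₁` of `P E Pᵀ`, where `P` lists the indices in `I` first. -/
def block21 {N : ℕ} (E : Matrix (Fin N) (Fin N) ℝ) (I : Finset (Fin N)) :
    Matrix {i // i ∉ I} {i // i ∈ I} ℝ :=
  E.submatrix Subtype.val Subtype.val

/-- The block `Ē₂₂` of `P E Pᵀ`, where `P` lists the indices in `I` first. -/
def block22 {N : ℕ} (E : Matrix (Fin N) (Fin N) ℝ) (I : Finset (Fin N)) :
    Matrix {i // i ∉ I} {i // i ∉ I} ℝ :=
  E.submatrix Subtype.val Subtype.val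

/-- The vector `y₂* = - Ē₂₂⁻¹ Ē₂₁ 𝟏`. -/
def reducedEquilibrium {N : ℕ} (E : Matrix (Fin N) (Fin N) ℝ) (I : Finset (Fin N)) :
    {i // i ∉ I} → ℝ :=
  -((block22 E I)⁻¹.mulVec ((block21 E I).mulVec (fun _ => 1)))

/-- The point `x* = Pᵀ y*` with `y* = (𝟏, y₂*)`: its entries are `1` on `I`
and those of `y₂*` off `I`. -/
def fullEquilibrium {N : ℕ} (E : Matrix (Fin N) (Fin N) ℝ) (I : Finset (Fin N)) :
    Fin N → ℝ :=
  fun i => if h : i ∈ I then 1 else reducedEquilibrium E I ⟨i, h⟩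

/-- The set `{x | x_i = 1 for i ∈ I, x_i ∈ [-1, 1) for i ∉ I}`. -/
def face {N : ℕ} (I : Finset (Fin N)) : Set (Fin N → ℝ) :=
  {x | (∀ i ∈ I, x i = 1) ∧ ∀ i, i ∉ I → x i ∈ Set.Ico (-1 : ℝ) 1}

/-- The set `J` of indices at which the vector attains its maximum norm
(the norm of `Fin N → ℝ` is the maximum norm). -/
def maxIndices {N : ℕ} (v : Fin N → ℝ) : Finset (Fin N) :=
  Finset.univ.filter (fun j => v j = ‖v‖)

end

end OpinionDynamics

/-! Since `C` is symmetric and `d ≥ ρ(C)`, the matrix `E = C - d I` is negative semidefinite;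
Perron's argument (`dominant_eigenvector`) shows that its kernel is trivial for `d > ρ(C)` and
spanned by `v` for `d = ρ(C)`.

Coordinates starting at `1` stay there and the others stay below `1`. Let `p` be an equilibrium on
the same face with `E p = 0` off `I`. The entropy-like sum `W = ∑ divergence (p i) (x i)` has
derivative `q / 2`, where `q = (x - p)ᵀ E (x - p) ≤ 0`, and symmetry makes `q` nondecreasing. Hence
`W` is bounded, which confines the trajectory to a compact set, and `-2 W(0) / t ≤ q(t) ≤ 0` forces
`q → 0` (`IsSolution.bounded_and_tendsto`).

Every cluster point therefore differs from `p` by a null vector of `E`. If no nonzero null vector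
vanishes on `I`, the limit is `p`. In the remaining case, `d = ρ(C)` and `I = ∅`, the cluster points
are multiples of `v`, and the first integral `∑ v i log (1 - x i)` singles out one of them. -/

open Matrix

namespace OpinionDynamics

/-! ### Perron theory and negative semidefiniteness for symmetric matrices. -/

section Spectral

variable {N : ℕ} {C : Matrix (Fin N) (Fin N) ℝ}

lemma isHermitian_of_isSymm {n : Type*} {M : Matrix n n ℝ} (hM : M.IsSymm) : M.IsHermitian := by
  rwa [Matrix.IsHermitian, Matrix.conjTranspose_eq_transpose_of_trivial]

lemma isSymm_pow {n : Type*} [Fintype n] [DecidableEq n] {M : Matrix n n ℝ} (hM : M.IsSymm)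
    (k : ℕ) : (M ^ k).IsSymm := by
  rw [Matrix.IsSymm, Matrix.transpose_pow, hM.eq]

lemma spectrum_complexification (hC : C.IsHermitian) :
    spectrum ℂ (C.map (fun r : ℝ => (r : ℂ))) = Set.range fun i => (hC.eigenvalues i : ℂ) := by
  ext z
  have h : (C.map (fun r : ℝ => (r : ℂ))).charpoly = C.charpoly.map Complex.ofRealHom :=
    Matrix.charpoly_map C Complex.ofRealHom
  rw [Matrix.mem_spectrum_iff_isRoot_charpoly, h, hC.charpoly_eq]
  simp only [Polynomial.IsRoot, Polynomial.map_prod, Polynomial.eval_prod, Finset.prod_eq_zero_iff]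
  simp [sub_eq_zero, eq_comm (b := z)]

lemma specRadius_eq_max_abs_eigenvalues (hN : 0 < N) (hC : C.IsHermitian) :
    (∃ i, |hC.eigenvalues i| = specRadius C) ∧ ∀ i, |hC.eigenvalues i| ≤ specRadius C := by
  have : Nonempty (Fin N) := ⟨⟨0, hN⟩⟩
  obtain ⟨i, hi⟩ := Finite.exists_max fun i => |hC.eigenvalues i|
  have h : specRadius C = |hC.eigenvalues i| := by
    have : spectralRadius ℂ (C.map (fun r : ℝ => (r : ℂ))) =
        (‖(hC.eigenvalues i : ℂ)‖₊ : ENNReal) := by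
      rw [spectralRadius, spectrum_complexification hC, iSup_range]
      refine le_antisymm (iSup_le fun j => ?_) (le_iSup (fun j =>
        (‖(hC.eigenvalues j : ℂ)‖₊ : ENNReal)) i)
      rw [ENNReal.coe_le_coe, ← NNReal.coe_le_coe]
      simpa using hi j
    rw [specRadius, this]
    simp
  exact ⟨⟨i, h.symm⟩, fun j => h ▸ hi j⟩

lemma specRadius_nonneg : 0 ≤ specRadius C := ENNReal.toReal_nonneg

lemma pow_mulVec_of_mulVec_eq_smul {n : Type*} [Fintype n] [DecidableEq n] {M : Matrix n n ℝ}
    {w : n → ℝ} {μ : ℝ} (h : M *ᵥ w = μ • w) (k : ℕ) : (M ^ k) *ᵥ w = μ ^ k • w := by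
  induction k with
  | zero => simp
  | succ k ih => rw [pow_succ, ← Matrix.mulVec_mulVec, h, Matrix.mulVec_smul, ih, smul_smul,
      pow_succ, mul_comm]

/-- Expand in an orthonormal eigenbasis and bound each `λ ^ k` by `ρ ^ k`. The case `k = 1` gives
the sign of `E`; an even power enters Perron's argument. -/
lemma dotProduct_pow_mulVec_le (hN : 0 < N) (hC : C.IsSymm) (k : ℕ) (x : Fin N → ℝ) :
    x ⬝ᵥ (C ^ k) *ᵥ x ≤ specRadius C ^ k * (x ⬝ᵥ x) := by
  have hH := isHermitian_of_isSymm hC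
  set b := hH.eigenvectorBasis
  have key : ∀ y : Fin N → ℝ, x ⬝ᵥ y = ∑ i, (x ⬝ᵥ ⇑(b i)) * (⇑(b i) ⬝ᵥ y) := by
    intro y
    have := b.sum_inner_mul_inner (WithLp.toLp 2 x) (WithLp.toLp 2 y)
    simp only [EuclideanSpace.inner_eq_star_dotProduct, star_trivial] at this
    rw [dotProduct_comm, ← this]
    refine Finset.sum_congr rfl fun i _ => ?_
    rw [dotProduct_comm, dotProduct_comm y]
  rw [key, key x, Finset.mul_sum]
  refine Finset.sum_le_sum fun i _ => ?_
  have h1 : ⇑(b i) ⬝ᵥ (C ^ k) *ᵥ x = hH.eigenvalues i ^ k * (⇑(b i) ⬝ᵥ x) := by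
    rw [dotProduct_mulVec, ← mulVec_transpose, (isSymm_pow hC k).eq,
      pow_mulVec_of_mulVec_eq_smul (hH.mulVec_eigenvectorBasis i), smul_dotProduct, smul_eq_mul]
  rw [h1, dotProduct_comm x]
  have h2 : hH.eigenvalues i ^ k ≤ specRadius C ^ k :=
    (le_abs_self _).trans (abs_pow (hH.eigenvalues i) k ▸
      pow_le_pow_left₀ (abs_nonneg _) ((specRadius_eq_max_abs_eigenvalues hN hH).2 i) k)
  nlinarith [mul_le_mul_of_nonneg_right h2 (mul_self_nonneg (⇑(b i) ⬝ᵥ x))]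

lemma mulVec_eq_zero_of_dotProduct_eq_zero {n : Type*} [Fintype n] {M : Matrix n n ℝ}
    (hM : M.IsSymm) (hneg : ∀ x : n → ℝ, x ⬝ᵥ M *ᵥ x ≤ 0) {x : n → ℝ}
    (hx : x ⬝ᵥ M *ᵥ x = 0) : M *ᵥ x = 0 := by
  have hP : (-M).PosSemidef := by
    refine Matrix.PosSemidef.of_dotProduct_mulVec_nonneg
      (isHermitian_of_isSymm (by rw [Matrix.IsSymm, Matrix.transpose_neg, hM.eq])) fun y => ?_
    simpa [neg_mulVec] using hneg y
  have := (hP.dotProduct_mulVec_zero_iff x).1 (by simpa [neg_mulVec] using hx)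
  simpa [neg_mulVec] using this

lemma dotProduct_sub_smul_one_mulVec (M : Matrix (Fin N) (Fin N) ℝ) (d : ℝ) (x : Fin N → ℝ) :
    x ⬝ᵥ (M - d • (1 : Matrix (Fin N) (Fin N) ℝ)) *ᵥ x = x ⬝ᵥ M *ᵥ x - d * (x ⬝ᵥ x) := by
  rw [sub_mulVec, smul_mulVec, one_mulVec, dotProduct_sub, dotProduct_smul, smul_eq_mul]

lemma isSymm_sub_smul_one {M : Matrix (Fin N) (Fin N) ℝ} (hM : M.IsSymm) (d : ℝ) :
    (M - d • (1 : Matrix (Fin N) (Fin N) ℝ)).IsSymm := by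
  rw [Matrix.IsSymm, Matrix.transpose_sub, Matrix.transpose_smul, Matrix.transpose_one, hM.eq]

/-- Perron's argument for a symmetric eventually positive matrix: an eigenvector for an eigenvalue
of maximal modulus has no zero entry, its entries' moduli form an eigenvector, and the eigenvalue
is the spectral radius. -/
lemma dominant_eigenvector (hN : 0 < N) (hC : C.IsSymm) (hpos : EventuallyPositive C)
    {u : Fin N → ℝ} {μ : ℝ} (hu : u ≠ 0) (hCu : C *ᵥ u = μ • u) (hμ : |μ| = specRadius C) :
    μ = specRadius C ∧ (∀ i, u i ≠ 0) ∧ IsRightPositiveEigenvector C (fun i => |u i|) := by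
  obtain ⟨k₀, hk₀, hk⟩ := hpos
  set ρ := specRadius C
  -- An even exponent hides the sign of `μ = ±ρ`, so `u` attains the maximal Rayleigh quotient of a
  -- positive matrix.
  set A := C ^ (2 * k₀)
  have hA : ∀ i j, 0 < A i j := hk _ (by omega)
  set w : Fin N → ℝ := fun i => |u i| with hw
  have hμk : μ ^ (2 * k₀) = ρ ^ (2 * k₀) := by
    rw [← hμ, pow_mul, pow_mul, sq_abs]
  have hAu : A *ᵥ u = ρ ^ (2 * k₀) • u := hμk ▸ pow_mulVec_of_mulVec_eq_smul hCu _
  have hww : w ⬝ᵥ w = u ⬝ᵥ u := by simp [dotProduct, hw]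
  have expand : ∀ y : Fin N → ℝ, y ⬝ᵥ A *ᵥ y = ∑ i, ∑ j, A i j * (y i * y j) := by
    intro y
    simp only [dotProduct, mulVec, Finset.mul_sum]
    exact Finset.sum_congr rfl fun i _ => Finset.sum_congr rfl fun j _ => by ring
  have hterm : ∀ i j, A i j * (u i * u j) ≤ A i j * (w i * w j) := fun i j =>
    mul_le_mul_of_nonneg_left ((le_abs_self _).trans (abs_mul _ _).le) (hA i j).le
  have hle : u ⬝ᵥ A *ᵥ u ≤ w ⬝ᵥ A *ᵥ w := by
    rw [expand, expand]
    exact Finset.sum_le_sum fun i _ => Finset.sum_le_sum fun j _ => hterm i j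
  have huA : u ⬝ᵥ A *ᵥ u = ρ ^ (2 * k₀) * (u ⬝ᵥ u) := by
    rw [hAu, dotProduct_smul, smul_eq_mul]
  -- Taking moduli keeps the norm and does not lower the form, so `w` is a maximizer too, hence an
  -- eigenvector of `A`.
  have hwA : w ⬝ᵥ A *ᵥ w = ρ ^ (2 * k₀) * (w ⬝ᵥ w) :=
    le_antisymm (dotProduct_pow_mulVec_le hN hC _ w) (by rw [hww, ← huA]; exact hle)
  have hAw : A *ᵥ w = ρ ^ (2 * k₀) • w := by
    have := mulVec_eq_zero_of_dotProduct_eq_zero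
      (isSymm_sub_smul_one (isSymm_pow hC (2 * k₀)) (ρ ^ (2 * k₀)))
      (fun x => by
        rw [dotProduct_sub_smul_one_mulVec]
        linarith [dotProduct_pow_mulVec_le hN hC (2 * k₀) x])
      (x := w) (by rw [dotProduct_sub_smul_one_mulVec]; linarith)
    rwa [sub_mulVec, smul_mulVec, one_mulVec, sub_eq_zero] at this
  obtain ⟨m, hm⟩ := Function.ne_iff.1 hu
  have hpos_of : ∀ M : Matrix (Fin N) (Fin N) ℝ, (∀ i j, 0 < M i j) → ∀ i, 0 < (M *ᵥ w) i :=
    fun M hM i => Finset.sum_pos' (fun j _ => mul_nonneg (hM i j).le (abs_nonneg _))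
      ⟨m, Finset.mem_univ _, mul_pos (hM i m) (abs_pos.2 hm)⟩
  have hu0 : ∀ i, u i ≠ 0 := by
    intro i h0
    have := hpos_of A hA i
    rw [hAw] at this
    simp [hw, h0] at this
  -- Equal sums with termwise inequality and positive weights: all entries of `u` share one sign.
  have heq : ∀ i j, u i * u j = w i * w j := by
    have h0 : ∑ i, ∑ j, A i j * (u i * u j) = ∑ i, ∑ j, A i j * (w i * w j) := by
      rw [← expand, ← expand, huA, hwA, hww]
    intro i j
    have h1 := (Finset.sum_eq_sum_iff_of_le fun i _ =>
      Finset.sum_le_sum fun j _ => hterm i j).1 h0 i (Finset.mem_univ _)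
    have h2 := (Finset.sum_eq_sum_iff_of_le fun j _ => hterm i j).1 h1 j (Finset.mem_univ _)
    exact mul_left_cancel₀ (hA i j).ne' h2
  have hwu : w = (u m / |u m|) • u := by
    ext i
    have := heq i m
    have hm' : |u m| ≠ 0 := abs_ne_zero.2 hm
    simp only [Pi.smul_apply, smul_eq_mul]
    field_simp
    linarith
  have hCw : C *ᵥ w = μ • w := by
    rw [hwu, mulVec_smul, hCu, smul_comm]
  have hμpos : 0 < μ := by
    -- An odd power recovers the sign of `μ`.
    have h1 := hpos_of _ (hk (2 * k₀ + 1) (by omega)) m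
    rw [pow_mulVec_of_mulVec_eq_smul hCw] at h1
    have h2 : 0 < μ ^ (2 * k₀ + 1) := by
      simp only [Pi.smul_apply, smul_eq_mul] at h1
      exact (pos_iff_pos_of_mul_pos h1).2 (abs_pos.2 hm)
    exact (Odd.pow_pos_iff ⟨k₀, rfl⟩).1 h2
  have hμρ : μ = ρ := by rw [← hμ, abs_of_pos hμpos]
  exact ⟨hμρ, hu0, fun i => abs_pos.2 (hu0 i), by change C *ᵥ w = ρ • w; rw [hCw, hμρ]⟩

lemma exists_isRightPositiveEigenvector (hN : 0 < N) (hC : C.IsSymm)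
    (hpos : EventuallyPositive C) : ∃ v, IsRightPositiveEigenvector C v := by
  have hH := isHermitian_of_isSymm hC
  obtain ⟨i, hi⟩ := (specRadius_eq_max_abs_eigenvalues hN hH).1
  exact ⟨_, (dominant_eigenvector hN hC hpos
    ((WithLp.ofLp_eq_zero 2).ne.2 (hH.eigenvectorBasis.orthonormal.ne_zero i))
    (hH.mulVec_eigenvectorBasis i) hi).2.2⟩

/-- Otherwise subtracting the multiple of `v` that cancels one entry leaves a dominant eigenvector
with a zero entry. -/
lemma eq_smul_of_mulVec_eq (hN : 0 < N) (hC : C.IsSymm) (hpos : EventuallyPositive C)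
    {v x : Fin N → ℝ} (hv : IsRightPositiveEigenvector C v)
    (hx : C *ᵥ x = specRadius C • x) : ∃ β : ℝ, x = β • v := by
  let m : Fin N := ⟨0, hN⟩
  refine ⟨x m / v m, ?_⟩
  by_contra hne
  have hm : v m ≠ 0 := (hv.1 m).ne'
  have h := (dominant_eigenvector hN hC hpos (u := x - (x m / v m) • v) (μ := specRadius C)
    (sub_ne_zero.2 hne) (by rw [mulVec_sub, mulVec_smul, hx, hv.2, smul_sub, smul_comm])
    (abs_of_nonneg specRadius_nonneg)).2.1 m
  apply h
  simp [hm]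

lemma dotProduct_mulVec_nonpos (hN : 0 < N) (hC : C.IsSymm) {d : ℝ} (hd : specRadius C ≤ d)
    (x : Fin N → ℝ) : x ⬝ᵥ (C - d • (1 : Matrix (Fin N) (Fin N) ℝ)) *ᵥ x ≤ 0 := by
  have h := dotProduct_pow_mulVec_le hN hC 1 x
  simp only [pow_one] at h
  have h2 : 0 ≤ x ⬝ᵥ x := Finset.sum_nonneg fun i _ => mul_self_nonneg _
  rw [dotProduct_sub_smul_one_mulVec]
  nlinarith [mul_le_mul_of_nonneg_right hd h2]

lemma eq_zero_of_dotProduct_mulVec_eq_zero (hN : 0 < N) (hC : C.IsSymm) {d : ℝ}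
    (hd : specRadius C < d) {x : Fin N → ℝ}
    (hx : x ⬝ᵥ (C - d • (1 : Matrix (Fin N) (Fin N) ℝ)) *ᵥ x = 0) : x = 0 := by
  have h := dotProduct_pow_mulVec_le hN hC 1 x
  simp only [pow_one] at h
  have h2 : 0 ≤ x ⬝ᵥ x := Finset.sum_nonneg fun i _ => mul_self_nonneg _
  rw [dotProduct_sub_smul_one_mulVec] at hx
  refine dotProduct_self_eq_zero.1 (le_antisymm ?_ h2)
  by_contra! h3
  nlinarith [mul_lt_mul_of_pos_right hd h3]

lemma exists_eq_smul_of_dotProduct_mulVec_eq_zero (hN : 0 < N) (hC : C.IsSymm)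
    (hpos : EventuallyPositive C) {d : ℝ} (hd : specRadius C ≤ d)
    {v : Fin N → ℝ} (hv : IsRightPositiveEigenvector C v) {x : Fin N → ℝ}
    (hx : x ⬝ᵥ (C - d • (1 : Matrix (Fin N) (Fin N) ℝ)) *ᵥ x = 0) :
    ∃ β : ℝ, x = β • v := by
  rcases hd.lt_or_eq with hlt | heq
  · exact ⟨0, by rw [zero_smul]; exact eq_zero_of_dotProduct_mulVec_eq_zero hN hC hlt hx⟩
  · refine eq_smul_of_mulVec_eq hN hC hpos hv ?_
    have := mulVec_eq_zero_of_dotProduct_eq_zero (isSymm_sub_smul_one hC d)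
      (dotProduct_mulVec_nonpos hN hC hd) hx
    rwa [sub_mulVec, smul_mulVec, one_mulVec, sub_eq_zero, ← heq] at this

end Spectral

/-! ### Invariant faces, the Lyapunov function and convergence. -/

section Dynamics

variable {N : ℕ} {E : Matrix (Fin N) (Fin N) ℝ} {x : ℝ → Fin N → ℝ}

lemma field_apply (E : Matrix (Fin N) (Fin N) ℝ) (y : Fin N → ℝ) (i : Fin N) :
    field E y i = 1 / 2 * (1 - y i) * (E *ᵥ y) i := by
  simp only [field, susceptibility, smul_mulVec, sub_mulVec, one_mulVec, Pi.smul_apply,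
    Pi.sub_apply, mulVec_diagonal, smul_eq_mul]
  ring

lemma IsSolution.hasDerivWithinAt_apply (hx : IsSolution E x) {t : ℝ} (ht : 0 ≤ t) (i : Fin N) :
    HasDerivWithinAt (fun s => x s i) (1 / 2 * (1 - x t i) * (E *ᵥ x t) i) (Set.Ici 0) t := by
  rw [← field_apply]
  exact hasDerivWithinAt_pi.1 (hx t ht) i

lemma IsSolution.continuousOn (hx : IsSolution E x) : ContinuousOn x (Set.Ici 0) :=
  fun t ht => (hx t ht).continuousWithinAt

/-- Each `1 - x i` solves a linear homogeneous differential equation, so it keeps its sign. -/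
lemma IsSolution.exists_one_sub_eq (hx : IsSolution E x) (i : Fin N) {t : ℝ} (ht : 0 ≤ t) :
    ∃ g : ℝ, 1 - x t i = (1 - x 0 i) * Real.exp g := by
  have hcont : Continuous fun s => x (max s 0) :=
    hx.continuousOn.comp_continuous (by fun_prop) fun s => Set.mem_Ici.2 (le_max_right _ _)
  -- Freezing `x` at its initial value for negative times makes the coefficient continuous on all of
  -- `ℝ`; `exp (-G)` is then the integrating factor.
  set a : ℝ → ℝ := fun s => -(1 / 2 * (E *ᵥ x (max s 0)) i) with ha
  have hac : Continuous a := by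
    have h : Continuous fun s => E *ᵥ x (max s 0) := continuous_const.matrix_mulVec hcont
    exact (continuous_const.mul (continuous_pi_iff.1 h i)).neg
  set G : ℝ → ℝ := fun s => ∫ r in (0 : ℝ)..s, a r with hG
  have hGd : ∀ s, HasDerivAt G (a s) s := fun s => (hac.integral_hasStrictDerivAt 0 s).hasDerivAt
  have hF : ∀ s, 0 ≤ s →
      HasDerivWithinAt (fun r => (1 - x r i) * Real.exp (-G r)) 0 (Set.Ici 0) s := by
    intro s hs
    have h1 := ((hx.hasDerivWithinAt_apply hs i).const_sub 1).mul
      (((hGd s).neg.exp).hasDerivWithinAt (s := Set.Ici 0))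
    refine h1.congr_deriv ?_
    simp only [ha, max_eq_left hs]
    ring
  have hconst := constant_of_has_deriv_right_zero (a := 0) (b := t)
    (f := fun r => (1 - x r i) * Real.exp (-G r))
    (fun s hs => (hF s hs.1).continuousWithinAt.mono Set.Icc_subset_Ici_self)
    (fun s hs => (hF s hs.1).mono (Set.Ici_subset_Ici.2 hs.1)) t ⟨ht, le_rfl⟩
  refine ⟨G t, ?_⟩
  have h0 : G 0 = 0 := by simp [hG]
  simp only [h0, neg_zero, Real.exp_zero, mul_one] at hconst
  rw [← hconst, mul_assoc, ← Real.exp_add]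
  simp

lemma IsSolution.eq_one (hx : IsSolution E x) {i : Fin N} (h0 : x 0 i = 1) {t : ℝ}
    (ht : 0 ≤ t) : x t i = 1 := by
  obtain ⟨g, hg⟩ := hx.exists_one_sub_eq i ht
  rw [h0] at hg
  linarith

lemma IsSolution.lt_one (hx : IsSolution E x) {i : Fin N} (h0 : x 0 i < 1) {t : ℝ}
    (ht : 0 ≤ t) : x t i < 1 := by
  obtain ⟨g, hg⟩ := hx.exists_one_sub_eq i ht
  have := mul_pos (sub_pos.2 h0) (Real.exp_pos g)
  linarith

/-- A convex function of `s < 1`, minimal at `p` with value `0`, whose derivative in `s` is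
`(s - p) / (1 - s)`. -/
noncomputable def divergence (p s : ℝ) : ℝ :=
  (1 - p) * ((1 - s) / (1 - p) - 1 - Real.log ((1 - s) / (1 - p)))

/-- Coordinates frozen at `1` drop out of the Lyapunov sum: the outer factor `1 - p` vanishes,
whatever the value of the quotient by zero. -/
lemma divergence_one (s : ℝ) : divergence 1 s = 0 := by simp [divergence]

lemma divergence_nonneg {p s : ℝ} (hp : p < 1) (hs : s < 1) : 0 ≤ divergence p s := by
  have h := Real.log_le_sub_one_of_pos (div_pos (sub_pos.2 hs) (sub_pos.2 hp))
  exact mul_nonneg (by linarith) (by linarith)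

/-- The denominator `1 - f t` is there to cancel the susceptibility in the vector field. -/
lemma hasDerivWithinAt_divergence {p : ℝ} (hp : p < 1) {f : ℝ → ℝ} {f' t : ℝ} {S : Set ℝ}
    (hf : HasDerivWithinAt f f' S t) (ht : f t < 1) :
    HasDerivWithinAt (fun r => divergence p (f r)) ((f t - p) / (1 - f t) * f') S t := by
  have h1 : (1 - p) ≠ 0 := by linarith
  have h2 : (1 - f t) ≠ 0 := by linarith
  have h3 := (hf.const_sub 1).div_const (1 - p)
  have h4 := ((h3.sub_const 1).sub (h3.log (div_ne_zero h2 h1))).const_mul (1 - p)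
  refine h4.congr_deriv ?_
  field_simp
  ring

/-- With `r = (1 - s) / (1 - p)`, the logarithm keeps `r` away from `0`, while `log (r / 2) ≤ r / 2
- 1` bounds it above. -/
lemma exists_bounds_of_divergence_le {p : ℝ} (hp : p < 1) (c : ℝ) :
    ∃ m M : ℝ, M < 1 ∧ ∀ s, s < 1 → divergence p s ≤ c → s ∈ Set.Icc m M := by
  have h1 : 0 < 1 - p := by linarith
  set c' := c / (1 - p)
  refine ⟨1 - (1 - p) * (2 * (c' + 1)), 1 - (1 - p) * Real.exp (-c' - 1),
    by have := mul_pos h1 (Real.exp_pos (-c' - 1)); linarith, fun s hs hc => ?_⟩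
  have hr : 0 < (1 - s) / (1 - p) := div_pos (by linarith) h1
  have hs' : (1 - s) = (1 - p) * ((1 - s) / (1 - p)) := by field_simp
  rw [divergence, ← le_div_iff₀' h1] at hc
  set r := (1 - s) / (1 - p)
  constructor
  · have h2 := Real.log_le_sub_one_of_pos (half_pos hr)
    rw [Real.log_div hr.ne' two_ne_zero] at h2
    have h3 := Real.log_two_lt_d9
    have : r ≤ 2 * (c' + 1) := by linarith
    have := mul_le_mul_of_nonneg_left this h1.le
    linarith
  · have : Real.exp (-c' - 1) ≤ r := (Real.le_log_iff_exp_le hr).1 (by linarith)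
    have := mul_le_mul_of_nonneg_left this h1.le
    linarith

/-- Trajectories on a face stay in a compact set at positive distance from the smaller faces, and
the quadratic form of `E` tends to zero along the deviation from an equilibrium `p`. -/
theorem IsSolution.bounded_and_tendsto (hx : IsSolution E x) (hE : E.IsSymm)
    (hneg : ∀ y : Fin N → ℝ, y ⬝ᵥ E *ᵥ y ≤ 0) {I : Finset (Fin N)} {p : Fin N → ℝ}
    (hpI : ∀ i ∈ I, p i = 1) (hp : ∀ i, i ∉ I → p i < 1) (hEp : ∀ i, i ∉ I → (E *ᵥ p) i = 0)
    (h0I : ∀ i ∈ I, x 0 i = 1) (h0 : ∀ i, i ∉ I → x 0 i < 1) :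
    (∃ m M : Fin N → ℝ, (∀ i, i ∉ I → M i < 1) ∧ ∀ t, 0 ≤ t → x t ∈ Set.Icc m M) ∧
      Tendsto (fun t => (x t - p) ⬝ᵥ E *ᵥ (x t - p)) atTop (𝓝 0) := by
  have hxI : ∀ t, 0 ≤ t → ∀ i ∈ I, x t i = 1 := fun t ht i hi => hx.eq_one (h0I i hi) ht
  have hxlt : ∀ t, 0 ≤ t → ∀ i, i ∉ I → x t i < 1 := fun t ht i hi => hx.lt_one (h0 i hi) ht
  have hEu : ∀ t i, i ∉ I → (E *ᵥ (x t - p)) i = (E *ᵥ x t) i := fun t i hi => by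
    rw [mulVec_sub, Pi.sub_apply, hEp i hi, sub_zero]
  set W : ℝ → ℝ := fun t => ∑ i, divergence (p i) (x t i) with hW
  set q : ℝ → ℝ := fun t => (x t - p) ⬝ᵥ E *ᵥ (x t - p) with hq
  have hWd : ∀ t, 0 ≤ t → HasDerivWithinAt W (1 / 2 * q t) (Set.Ici 0) t := by
    intro t ht
    simp only [hW, hq, dotProduct, Finset.mul_sum]
    refine HasDerivWithinAt.fun_sum fun i _ => ?_
    by_cases hi : i ∈ I
    · simp only [hpI i hi, divergence_one, Pi.sub_apply, hxI t ht i hi, sub_self, zero_mul,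
        mul_zero]
      exact hasDerivWithinAt_const _ _ _
    · refine (hasDerivWithinAt_divergence (hp i hi) (hx.hasDerivWithinAt_apply ht i)
        (hxlt t ht i hi)).congr_deriv ?_
      have : 1 - x t i ≠ 0 := by linarith [hxlt t ht i hi]
      rw [hEu t i hi, Pi.sub_apply]
      field_simp
  have hqd : ∀ t, 0 ≤ t → HasDerivWithinAt q
      (∑ i, (1 - x t i) * (E *ᵥ (x t - p)) i ^ 2) (Set.Ici 0) t := by
    intro t ht
    have hud : ∀ i, HasDerivWithinAt (fun s => (x s - p) i) (field E (x t) i) (Set.Ici 0) t :=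
      fun i => (hasDerivWithinAt_pi.1 (hx t ht) i).sub_const _
    have hEud : ∀ i, HasDerivWithinAt (fun s => (E *ᵥ (x s - p)) i) ((E *ᵥ field E (x t)) i)
        (Set.Ici 0) t := fun i => by
      simp only [mulVec, dotProduct]
      exact HasDerivWithinAt.fun_sum fun j _ => (hud j).const_mul _
    have h1 : HasDerivWithinAt q (∑ i, (field E (x t) i * (E *ᵥ (x t - p)) i +
        (x t - p) i * (E *ᵥ field E (x t)) i)) (Set.Ici 0) t := by
      simp only [hq]
      exact HasDerivWithinAt.fun_sum fun i _ => (hud i).mul (hEud i)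
    refine h1.congr_deriv ?_
    -- Symmetry of `E` makes the two halves of the derivative equal; the resulting `2` cancels the
    -- `1 / 2` of the field.
    have h2 : (x t - p) ⬝ᵥ E *ᵥ field E (x t) = field E (x t) ⬝ᵥ E *ᵥ (x t - p) := by
      rw [dotProduct_mulVec, ← mulVec_transpose, hE.eq, dotProduct_comm]
    rw [Finset.sum_add_distrib]
    change field E (x t) ⬝ᵥ E *ᵥ (x t - p) + (x t - p) ⬝ᵥ E *ᵥ field E (x t) = _
    rw [h2, ← two_mul, dotProduct, Finset.mul_sum]
    refine Finset.sum_congr rfl fun i _ => ?_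
    rw [field_apply]
    by_cases hi : i ∈ I
    · rw [hxI t ht i hi]; ring
    · rw [hEu t i hi]; ring
  have hq'nonneg : ∀ t, 0 ≤ t → 0 ≤ ∑ i, (1 - x t i) * (E *ᵥ (x t - p)) i ^ 2 := by
    intro t ht
    refine Finset.sum_nonneg fun i _ => mul_nonneg ?_ (sq_nonneg _)
    by_cases hi : i ∈ I
    · rw [hxI t ht i hi, sub_self]
    · linarith [hxlt t ht i hi]
  have hdiv : ∀ t, 0 ≤ t → ∀ i, 0 ≤ divergence (p i) (x t i) := by
    intro t ht i
    by_cases hi : i ∈ I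
    · rw [hpI i hi, divergence_one]
    · exact divergence_nonneg (hp i hi) (hxlt t ht i hi)
  have hanti : ∀ {f f' : ℝ → ℝ}, (∀ t, 0 ≤ t → HasDerivWithinAt f (f' t) (Set.Ici 0) t) →
      (∀ t, 0 ≤ t → f' t ≤ 0) → ∀ t, 0 ≤ t → f t ≤ f 0 := by
    intro f f' hf hf' t ht
    refine antitoneOn_of_hasDerivWithinAt_nonpos (f' := f') (convex_Ici 0)
      (fun s hs => (hf s hs).continuousWithinAt)
      (fun s hs => (hf s (interior_subset hs)).mono interior_subset)
      (fun s hs => hf' s (interior_subset hs)) Set.self_mem_Ici ht ht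
  have hWle : ∀ t, 0 ≤ t → W t ≤ W 0 :=
    hanti hWd fun t _ => by linarith [hneg (x t - p)]
  refine ⟨?_, ?_⟩
  · have hb : ∀ i, ∃ m M : ℝ, (i ∉ I → M < 1) ∧ ∀ t, 0 ≤ t → x t i ∈ Set.Icc m M := by
      intro i
      by_cases hi : i ∈ I
      · exact ⟨1, 1, fun h => absurd hi h, fun t ht => by simp [hxI t ht i hi]⟩
      · obtain ⟨m, M, hM, h⟩ := exists_bounds_of_divergence_le (hp i hi) (W 0)
        exact ⟨m, M, fun _ => hM, fun t ht => h _ (hxlt t ht i hi)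
          ((Finset.single_le_sum (fun j _ => hdiv t ht j) (Finset.mem_univ i)).trans
            (hWle t ht))⟩
    choose m M hM h using hb
    exact ⟨m, M, hM, fun t ht => ⟨fun i => (h i t ht).1, fun i => (h i t ht).2⟩⟩
  -- The derivative of the left side is `-t q' / 2 ≤ 0`, as the terms `q / 2` cancel.
  · have hbound : ∀ t, 0 ≤ t → W t - 1 / 2 * (t * q t) ≤ W 0 := by
      intro t ht
      have := hanti (f := fun t => W t - 1 / 2 * (t * q t))
        (fun s hs => (hWd s hs).sub ((((hasDerivAt_id s).hasDerivWithinAt).mul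
          (hqd s hs)).const_mul (1 / 2)))
        (fun s hs => by
          have := mul_nonneg hs (hq'nonneg s hs)
          simp only [id]
          linarith) t ht
      simpa using this
    have hW0 : ∀ t, 0 ≤ t → 0 ≤ W t := fun t ht => Finset.sum_nonneg fun i _ => hdiv t ht i
    have hlim : Tendsto (fun t : ℝ => -(2 * W 0) / t) atTop (𝓝 0) :=
      tendsto_const_nhds.div_atTop tendsto_id
    refine tendsto_of_tendsto_of_tendsto_of_le_of_le' hlim tendsto_const_nhds ?_
      (Eventually.of_forall fun t => hneg _)
    filter_upwards [eventually_gt_atTop 0] with t ht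
    rw [div_le_iff₀ ht]
    linarith [hbound t ht.le, hW0 t ht.le]

lemma eq_of_mapClusterPt {g : (Fin N → ℝ) → ℝ} {y : Fin N → ℝ} {c : ℝ}
    (hy : MapClusterPt y atTop x) (hg : ContinuousAt g y)
    (hlim : Tendsto (fun t => g (x t)) atTop (𝓝 c)) : g y = c := by
  have h : MapClusterPt (g y) atTop (g ∘ x) := hy.continuousAt_comp hg
  have h' : ClusterPt (g y) (𝓝 c) := ClusterPt.mono h hlim
  exact eq_of_nhds_neBot h'

/-- If the only deviation supported off `I` on which the form vanishes is zero, every trajectory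
on the face converges to the equilibrium. -/
theorem IsSolution.tendsto_of_definite (hx : IsSolution E x) (hE : E.IsSymm)
    (hneg : ∀ y : Fin N → ℝ, y ⬝ᵥ E *ᵥ y ≤ 0) {I : Finset (Fin N)} {p : Fin N → ℝ}
    (hpI : ∀ i ∈ I, p i = 1) (hp : ∀ i, i ∉ I → p i < 1) (hEp : ∀ i, i ∉ I → (E *ᵥ p) i = 0)
    (h0I : ∀ i ∈ I, x 0 i = 1) (h0 : ∀ i, i ∉ I → x 0 i < 1)
    (hdef : ∀ u : Fin N → ℝ, (∀ i ∈ I, u i = 0) → u ⬝ᵥ E *ᵥ u = 0 → u = 0) :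
    Tendsto x atTop (𝓝 p) := by
  obtain ⟨⟨m, M, -, hmem⟩, hq⟩ := hx.bounded_and_tendsto hE hneg hpI hp hEp h0I h0
  refine (isCompact_Icc (a := m) (b := M)).tendsto_nhds_of_unique_mapClusterPt
    ((eventually_ge_atTop 0).mono hmem) fun y _ hy => ?_
  have hcont : Continuous fun y : Fin N → ℝ => (y - p) ⬝ᵥ E *ᵥ (y - p) := by
    have : Continuous fun y : Fin N → ℝ => y - p := by fun_prop
    exact this.dotProduct (continuous_const.matrix_mulVec this)
  have h1 := eq_of_mapClusterPt (g := fun y => (y - p) ⬝ᵥ E *ᵥ (y - p)) hy hcont.continuousAt hq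
  refine sub_eq_zero.1 (hdef (y - p) (fun i hi => ?_) h1)
  have h2 : y i = 1 := eq_of_mapClusterPt (g := fun y => y i) hy (continuous_apply i).continuousAt
    (tendsto_const_nhds.congr' ((eventually_ge_atTop 0).mono fun t ht =>
      (hx.eq_one (h0I i hi) ht).symm))
  rw [Pi.sub_apply, h2, hpI i hi, sub_self]

/-- When `E` annihilates a positive vector, `∑ v i log (1 - x i)` is a first integral. -/
lemma IsSolution.log_sum_eq (hx : IsSolution E x) {v : Fin N → ℝ} (hE : E.IsSymm)
    (hEv : E *ᵥ v = 0) (h0 : ∀ i, x 0 i < 1) {t : ℝ} (ht : 0 ≤ t) :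
    ∑ i, v i * Real.log (1 - x t i) = ∑ i, v i * Real.log (1 - x 0 i) := by
  have hd : ∀ s, 0 ≤ s → HasDerivWithinAt (fun r => ∑ i, v i * Real.log (1 - x r i)) 0
      (Set.Ici 0) s := by
    intro s hs
    have hne : ∀ i, 1 - x s i ≠ 0 := fun i => by linarith [hx.lt_one (h0 i) hs]
    have h1 : HasDerivWithinAt (fun r => ∑ i, v i * Real.log (1 - x r i))
        (∑ i, v i * (-(1 / 2 * (1 - x s i) * (E *ᵥ x s) i) / (1 - x s i))) (Set.Ici 0) s :=
      HasDerivWithinAt.fun_sum fun i _ =>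
        (((hx.hasDerivWithinAt_apply hs i).const_sub 1).log (hne i)).const_mul _
    refine h1.congr_deriv ?_
    have h2 : v ⬝ᵥ E *ᵥ x s = 0 := by
      rw [dotProduct_mulVec, ← mulVec_transpose, hE.eq, hEv, zero_dotProduct]
    have h3 : ∑ i, v i * (-(1 / 2 * (1 - x s i) * (E *ᵥ x s) i) / (1 - x s i)) =
        -(1 / 2) * (v ⬝ᵥ E *ᵥ x s) := by
      rw [dotProduct, Finset.mul_sum]
      refine Finset.sum_congr rfl fun i _ => ?_
      have := hne i
      field_simp
    rw [h3, h2, mul_zero]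
  exact constant_of_has_deriv_right_zero (a := 0) (b := t)
    (f := fun r => ∑ i, v i * Real.log (1 - x r i))
    (fun s hs => (hd s hs.1).continuousWithinAt.mono Set.Icc_subset_Ici_self)
    (fun s hs => (hd s hs.1).mono (Set.Ici_subset_Ici.2 hs.1)) t ⟨ht, le_rfl⟩

/-- If `E` is negative semidefinite with kernel spanned by a positive vector `v`, every trajectory
starting below `1` converges to a multiple of `v` which is below `1`. -/
theorem IsSolution.exists_tendsto_smul (hx : IsSolution E x) (hN : 0 < N) (hE : E.IsSymm)
    (hneg : ∀ y : Fin N → ℝ, y ⬝ᵥ E *ᵥ y ≤ 0) {v : Fin N → ℝ} (hv : ∀ i, 0 < v i)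
    (hEv : E *ᵥ v = 0) (hker : ∀ y : Fin N → ℝ, y ⬝ᵥ E *ᵥ y = 0 → ∃ β : ℝ, y = β • v)
    (h0 : ∀ i, x 0 i < 1) :
    ∃ α : ℝ, Tendsto x atTop (𝓝 (α • v)) ∧ ∀ i, α * v i < 1 := by
  obtain ⟨⟨m, M, hM, hmem⟩, hq⟩ := hx.bounded_and_tendsto hE hneg (I := ∅) (p := 0) (by simp)
    (by simp) (by simp) (by simp) (fun i _ => h0 i)
  simp only [sub_zero] at hq
  set c := ∑ i, v i * Real.log (1 - x 0 i)
  have hcl : ∀ y ∈ Set.Icc m M, MapClusterPt y atTop x →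
      ∃ β : ℝ, y = β • v ∧ (∀ i, β * v i < 1) ∧ ∑ i, v i * Real.log (1 - β * v i) = c := by
    intro y hyK hy
    have hcont : Continuous fun y : Fin N → ℝ => y ⬝ᵥ E *ᵥ y :=
      continuous_id.dotProduct (continuous_const.matrix_mulVec continuous_id)
    obtain ⟨β, rfl⟩ := hker y
      (eq_of_mapClusterPt (g := fun y => y ⬝ᵥ E *ᵥ y) hy hcont.continuousAt hq)
    have hlt : ∀ i, β * v i < 1 := fun i => (hyK.2 i).trans_lt (hM i (by simp))
    refine ⟨β, rfl, hlt, ?_⟩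
    refine eq_of_mapClusterPt (g := fun y => ∑ i, v i * Real.log (1 - y i)) hy ?_
      (tendsto_const_nhds.congr' ((eventually_ge_atTop 0).mono fun t ht =>
        (hx.log_sum_eq hE hEv h0 ht).symm))
    refine tendsto_finsetSum _ fun i _ => ?_
    have : ContinuousAt (fun y : Fin N → ℝ => 1 - y i) (β • v) :=
      continuousAt_const.sub (continuous_apply i).continuousAt
    exact (this.log (by have := hlt i; simp only [Pi.smul_apply, smul_eq_mul]; linarith)).const_mul _
  -- The first integral is strictly decreasing along the ray of `v`, so it takes the value `c` at
  -- most once there.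
  have hmono : ∀ β γ : ℝ, (∀ i, γ * v i < 1) → β < γ →
      ∑ i, v i * Real.log (1 - γ * v i) < ∑ i, v i * Real.log (1 - β * v i) := by
    intro β γ hγ hlt
    refine Finset.sum_lt_sum_of_nonempty ⟨⟨0, hN⟩, Finset.mem_univ _⟩ fun i _ => ?_
    refine mul_lt_mul_of_pos_left (Real.log_lt_log (by linarith [hγ i]) ?_) (hv i)
    linarith [mul_lt_mul_of_pos_right hlt (hv i)]
  have hev : ∀ᶠ t in atTop, x t ∈ Set.Icc m M := (eventually_ge_atTop 0).mono hmem
  obtain ⟨z, hzK, hz⟩ := (isCompact_Icc (a := m) (b := M)).exists_mapClusterPt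
    (tendsto_principal.2 hev)
  obtain ⟨α, rfl, hα, hαc⟩ := hcl z hzK hz
  refine ⟨α, isCompact_Icc.tendsto_nhds_of_unique_mapClusterPt hev fun y hyK hy => ?_, hα⟩
  obtain ⟨β, rfl, hβ, hβc⟩ := hcl y hyK hy
  rcases lt_trichotomy β α with h | h | h
  · exact absurd (hαc.trans hβc.symm) (hmono β α hα h).ne
  · rw [h]
  · exact absurd (hβc.trans hαc.symm) (hmono α β hβ h).ne

end Dynamics

/-! ### Block form of the equilibria on a face. -/

section Equilibria

variable {N : ℕ}

lemma exists_apply_eq_norm (hN : 0 < N) {v : Fin N → ℝ} (hv : ∀ i, 0 < v i) :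
    ∃ i, v i = ‖v‖ := by
  have : Nonempty (Fin N) := ⟨⟨0, hN⟩⟩
  obtain ⟨i, hi⟩ := Finite.exists_max v
  refine ⟨i, le_antisymm ((le_abs_self _).trans (norm_le_pi_norm v i)) ?_⟩
  refine (pi_norm_le_iff_of_nonneg (hv i).le).2 fun j => ?_
  rw [Real.norm_of_nonneg (hv j).le]
  exact hi j

lemma mulVec_eq_block_mulVec (E : Matrix (Fin N) (Fin N) ℝ) (I : Finset (Fin N))
    (y : Fin N → ℝ) (i : {i // i ∉ I}) :
    (E *ᵥ y) i = (block21 E I *ᵥ fun j => y j) i + (block22 E I *ᵥ fun j => y j) i := by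
  simp only [mulVec, dotProduct, block21, block22, submatrix_apply]
  convert (Fintype.sum_subtype_add_sum_subtype (· ∈ I) fun j => E i j * y j).symm

lemma fullEquilibrium_of_mem {E : Matrix (Fin N) (Fin N) ℝ} {I : Finset (Fin N)} {i : Fin N}
    (hi : i ∈ I) : fullEquilibrium E I i = 1 := by
  simp [fullEquilibrium, hi]

lemma fullEquilibrium_of_notMem {E : Matrix (Fin N) (Fin N) ℝ} {I : Finset (Fin N)} {i : Fin N}
    (hi : i ∉ I) : fullEquilibrium E I i = reducedEquilibrium E I ⟨i, hi⟩ := by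
  simp [fullEquilibrium, hi]

lemma mulVec_fullEquilibrium {E : Matrix (Fin N) (Fin N) ℝ} {I : Finset (Fin N)}
    (hdet : IsUnit (block22 E I).det) {i : Fin N} (hi : i ∉ I) :
    (E *ᵥ fullEquilibrium E I) i = 0 := by
  have h1 : (fun j : {j // j ∈ I} => fullEquilibrium E I j) = fun _ => 1 :=
    funext fun j => fullEquilibrium_of_mem j.2
  have h2 : (fun j : {j // j ∉ I} => fullEquilibrium E I j) = reducedEquilibrium E I :=
    funext fun j => fullEquilibrium_of_notMem j.2
  rw [mulVec_eq_block_mulVec E I _ ⟨i, hi⟩, h1, h2, reducedEquilibrium, mulVec_neg,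
    mulVec_mulVec, mul_nonsing_inv _ hdet, one_mulVec, Pi.neg_apply, add_neg_cancel]

lemma isEquilibrium_fullEquilibrium {E : Matrix (Fin N) (Fin N) ℝ} {I : Finset (Fin N)}
    (hdet : IsUnit (block22 E I).det) : IsEquilibrium E (fullEquilibrium E I) := by
  ext i
  rw [field_apply]
  by_cases hi : i ∈ I
  · simp [fullEquilibrium_of_mem hi]
  · simp [mulVec_fullEquilibrium hdet hi]

/-- Supplies the definiteness on deviations off `I` that makes the equilibrium attract its face. -/
lemma eq_zero_of_block22_isUnit {E : Matrix (Fin N) (Fin N) ℝ} {I : Finset (Fin N)}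
    (hdet : IsUnit (block22 E I).det) {u : Fin N → ℝ} (huI : ∀ i ∈ I, u i = 0)
    (hEu : E *ᵥ u = 0) : u = 0 := by
  have h1 : (fun j : {j // j ∈ I} => u j) = 0 := funext fun j => huI j j.2
  have h2 : (block22 E I *ᵥ fun j => u j) = 0 := by
    ext i
    have := mulVec_eq_block_mulVec E I u i
    rwa [hEu, h1, mulVec_zero, Pi.zero_apply, Pi.zero_apply, zero_add, eq_comm] at this
  have h3 : (fun j : {j // j ∉ I} => u j) = 0 := by
    rw [← one_mulVec (fun j : {j // j ∉ I} => u j), ← nonsing_inv_mul _ hdet, ← mulVec_mulVec,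
      h2, mulVec_zero]
  ext i
  by_cases hi : i ∈ I
  · exact huI i hi
  · exact congrFun h3 ⟨i, hi⟩

end Equilibria

/-! ### Common form of the two assumptions, and the main theorem. -/

lemma systemMatrix_eq {N : ℕ} {B C : Matrix (Fin N) (Fin N) ℝ} {σ : Fin N → ℝ} {d : ℝ}
    (hB : B.IsSymm)
    (h : (AssumptionOne B σ d ∧ C = B) ∨ (AssumptionTwo B σ d ∧ C = shiftedMatrix B σ d)) :
    systemMatrix B σ = C - d • (1 : Matrix (Fin N) (Fin N) ℝ) ∧ C.IsSymm ∧
      EventuallyPositive C ∧ specRadius C ≤ d := by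
  rcases h with ⟨⟨hpos, hσ, hd⟩, rfl⟩ | ⟨⟨-, hpos, hd⟩, rfl⟩
  · refine ⟨?_, hB, hpos, hd⟩
    rw [systemMatrix, funext hσ, smul_one_eq_diagonal]
  · refine ⟨?_, ?_, hpos, hd⟩
    · rw [systemMatrix, shiftedMatrix]
      abel
    · rw [Matrix.IsSymm, shiftedMatrix, transpose_add, transpose_sub, transpose_smul,
        transpose_one, diagonal_transpose, hB.eq]

end OpinionDynamics

open OpinionDynamics in
theorem corollary1 (N : ℕ) (hN : 0 < N)
    (B : Matrix (Fin N) (Fin N) ℝ) (σ : Fin N → ℝ)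
    (hB : OpinionDynamics.IsSignedAdjacency B) (hσ : ∀ i, 0 < σ i)
    (hundirected : B.IsSymm)
    (C : Matrix (Fin N) (Fin N) ℝ) (d : ℝ)
    (hassumption :
      (OpinionDynamics.AssumptionOne B σ d ∧ C = B) ∨
      (OpinionDynamics.AssumptionTwo B σ d ∧ C = OpinionDynamics.shiftedMatrix B σ d)) :
    -- the right positive eigenvector exists
    (∃ v, OpinionDynamics.IsRightPositiveEigenvector C v) ∧
    -- 1)
    (∀ v, OpinionDynamics.IsRightPositiveEigenvector C v →
      ∀ x, OpinionDynamics.IsSolution (OpinionDynamics.systemMatrix B σ) x →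
        (∀ i, x 0 i ∈ Set.Ico (-1 : ℝ) 1) →
        ∃ α : ℝ, Tendsto x atTop (𝓝 (α • v)) ∧ α < 1 / ‖v‖ ∧
          ((∀ t : ℝ, 0 ≤ t → ∀ i, x t i ∈ Set.Icc (-1 : ℝ) 1) → -(1 / ‖v‖) ≤ α)) ∧
    -- 2)
    (∀ I : Finset (Fin N), I.Nonempty → Iᶜ.Nonempty →
      IsUnit (OpinionDynamics.block22 (OpinionDynamics.systemMatrix B σ) I).det →
      (∀ i, OpinionDynamics.reducedEquilibrium (OpinionDynamics.systemMatrix B σ) I i ∈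
        Set.Ico (-1 : ℝ) 1) →
      OpinionDynamics.IsEquilibrium (OpinionDynamics.systemMatrix B σ)
        (OpinionDynamics.fullEquilibrium (OpinionDynamics.systemMatrix B σ) I) ∧
      ∀ x, OpinionDynamics.IsSolution (OpinionDynamics.systemMatrix B σ) x →
        x 0 ∈ OpinionDynamics.face I →
        Tendsto x atTop
          (𝓝 (OpinionDynamics.fullEquilibrium (OpinionDynamics.systemMatrix B σ) I))) ∧
    -- 3)
    (d = OpinionDynamics.specRadius C →
      ∀ v, OpinionDynamics.IsRightPositiveEigenvector C v → v ≠ (fun _ => 1) →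
      ∀ x, OpinionDynamics.IsSolution (OpinionDynamics.systemMatrix B σ) x →
        x 0 ∈ OpinionDynamics.face (OpinionDynamics.maxIndices v) →
        Tendsto x atTop (𝓝 ((1 / ‖v‖) • v)))
    := by

  obtain ⟨hEC, hC, hpos, hd⟩ := systemMatrix_eq hundirected hassumption
  have hneg := dotProduct_mulVec_nonpos hN hC hd
  have hEs := isSymm_sub_smul_one hC d
  have hker : ∀ v, IsRightPositiveEigenvector C v → d = specRadius C →
      (C - d • (1 : Matrix (Fin N) (Fin N) ℝ)) *ᵥ v = 0 := fun v hv h => by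
    rw [sub_mulVec, smul_mulVec, one_mulVec, hv.2, h, sub_self]
  rw [hEC]
  refine ⟨exists_isRightPositiveEigenvector hN hC hpos, ?_, ?_, ?_⟩
  · intro v hv x hx h0
    obtain ⟨m, hm⟩ := exists_apply_eq_norm hN hv.1
    have hnorm : 0 < ‖v‖ := hm ▸ hv.1 m
    have key : ∃ α : ℝ, Tendsto x atTop (𝓝 (α • v)) ∧ ∀ i, α * v i < 1 := by
      rcases hd.lt_or_eq with hlt | heq
      -- For `d > ρ(C)` the form is definite and the origin attracts, so `α = 0`.
      · refine ⟨0, ?_, by simp⟩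
        rw [zero_smul]
        exact hx.tendsto_of_definite hEs hneg (I := ∅) (by simp) (by simp) (by simp) (by simp)
          (fun i _ => (h0 i).2) fun u _ hu => eq_zero_of_dotProduct_mulVec_eq_zero hN hC hlt hu
      · exact hx.exists_tendsto_smul hN hEs hneg hv.1 (hker v hv heq.symm)
          (fun y hy => exists_eq_smul_of_dotProduct_mulVec_eq_zero hN hC hpos hd hv hy)
          fun i => (h0 i).2
    obtain ⟨α, hα, hlt⟩ := key
    refine ⟨α, hα, (lt_div_iff₀ hnorm).2 (hm ▸ hlt m), fun hIcc => ?_⟩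
    have h1 : -1 ≤ α * v m := ge_of_tendsto (tendsto_pi_nhds.1 hα m)
      ((eventually_ge_atTop 0).mono fun t ht => (hIcc t ht m).1)
    rw [← neg_div, div_le_iff₀ hnorm, ← hm]
    exact h1
  · intro I _ _ hdet hy
    refine ⟨isEquilibrium_fullEquilibrium hdet, fun x hx h0 => ?_⟩
    exact hx.tendsto_of_definite hEs hneg (fun i hi => fullEquilibrium_of_mem hi)
      (fun i hi => by rw [fullEquilibrium_of_notMem hi]; exact (hy ⟨i, hi⟩).2)
      (fun i hi => mulVec_fullEquilibrium hdet hi) h0.1 (fun i hi => (h0.2 i hi).2)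
      fun u huI hu => eq_zero_of_block22_isUnit hdet huI
        (mulVec_eq_zero_of_dotProduct_eq_zero hEs hneg hu)
  · intro hdρ v hv _ x hx h0
    obtain ⟨m, hm⟩ := exists_apply_eq_norm hN hv.1
    have hnorm : 0 < ‖v‖ := hm ▸ hv.1 m
    have hmem : ∀ i, i ∈ maxIndices v ↔ v i = ‖v‖ := fun i => by simp [maxIndices]
    refine hx.tendsto_of_definite hEs hneg (I := maxIndices v) (fun i hi => ?_) (fun i hi => ?_)
      (fun i _ => ?_) h0.1 (fun i hi => (h0.2 i hi).2) fun u huI hu => ?_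
    · simp [(hmem i).1 hi, hnorm.ne']
    · have h1 : v i < ‖v‖ := lt_of_le_of_ne ((le_abs_self _).trans (norm_le_pi_norm v i))
        fun h => hi ((hmem i).2 h)
      rw [Pi.smul_apply, smul_eq_mul, one_div_mul_eq_div, div_lt_one hnorm]
      exact h1
    · rw [mulVec_smul, hker v hv hdρ, smul_zero, Pi.zero_apply]
    -- A null deviation is a multiple of the positive `v`, yet it vanishes at a maximal index.
    · obtain ⟨β, rfl⟩ := exists_eq_smul_of_dotProduct_mulVec_eq_zero hN hC hpos hd hv hu
      have h1 : β * v m = 0 := huI m ((hmem m).2 hm)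
      rw [(mul_eq_zero.1 h1).resolve_right (hv.1 m).ne', zero_smul]
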